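/- Let $\mathcal X\subseteq\mathbb R^N$, let $\{f(\cdot;\mathbf x)\}_{\mathbf x\in\mathcal X}$ be probability densities on $\mathbb R^M$ with respect to a common measure $\mu$, and write $\mathsf P_{\mathbf x}$, $\mathsf E_{\mathbf x}$ for the corresponding distributions and expectations. Let $\mathbf x_0$ be an interior point of $\mathcal X$ with $f(\mathbf y;\mathbf x_0)\neq 0$ for $\mu$-almost every $\mathbf y$, put $\rho(\mathbf y,\mathbf x)=f(\mathbf y;\mathbf x)/f(\mathbf y;\mathbf x_0)$ (and $0$ where $f(\mathbf y;\mathbf x_0)=0$), and assume that $$R(\mathbf x_1,\mathbf x_2)=\mathsf E_{\mathbf x_0}\{\rho(\mathbf y,\mathbf x_1)\rho(\mathbf y,\mathbf x_2)\}$$ is finite for all $\mathbf x_1,\mathbf x_2\in\mathcal X$. Let $\mathcal H$ be the reproducing kernel Hilbert space of functions on $\mathcal X$ with kernel $R$. Assume that the problem is regular up to order $1$ at $\mathbf x_0$, that is, there is an $r>0$ such that the open ball $B=\mathcal B(\mathbf x_0,r)$ is contained in $\mathcal X$ and, for all multi-indices $\mathbf p,\mathbf p_1,\mathbf p_2\in\{0,1\}^N$: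 (i) for $\mu$-almost every $\mathbf y$ the partial derivative $\partial^{\mathbf p}f(\mathbf y;\mathbf x)/\partial\mathbf x^{\mathbf p}$ exists for all $\mathbf x\in B$, and $\mathsf E_{\mathbf x_0}\big\{\big(f(\mathbf y;\mathbf x_0)^{-1}\,\partial^{\mathbf p}f(\mathbf y;\mathbf x)/\partial\mathbf x^{\mathbf p}\big)^2\big\}<\infty$ for all $\mathbf x\in B$; (ii) for every measurable $h:\mathbb R^M\to\mathbb R$ such that $\mathsf E_{\mathbf x}\{h(\mathbf y)\}$ exists for all $\mathbf x\in\mathcal X$, if $h\,\partial^{\mathbf p}f(\cdot;\mathbf x)/\partial\mathbf x^{\mathbf p}$ is $\mu$-integrable for all $\mathbf x\in B$, then $$\frac{\partial^{\mathbf p}}{\partial\mathbf x^{\mathbf p}}\int h(\mathbf y)f(\mathbf y;\mathbf x)\,d\mu(\mathbf y)=\int h(\mathbf y)\frac{\partial^{\mathbf p}f(\mathbf y;\mathbf x)}{\partial\mathbf x^{\mathbf p}}\,d\mu(\mathbf y)\quad\text{for all }\mathbf x\in B,$$ the derivative on the left existing; (iii) $\mathsf E_{\mathbf x_0}\big\{f(\mathbf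 y;\mathbf x_0)^{-2}\,\frac{\partial^{\mathbf p_1}f(\mathbf y;\mathbf x_1)}{\partial\mathbf x_1^{\mathbf p_1}}\,\frac{\partial^{\mathbf p_2}f(\mathbf y;\mathbf x_2)}{\partial\mathbf x_2^{\mathbf p_2}}\big\}$ is continuous in $(\mathbf x_1,\mathbf x_2)\in B\times B$. Let $\hat g:\mathbb R^M\to\mathbb R$ be an estimator with finite variance $v(\hat g;\mathbf x_0)$ under $\mathsf P_{\mathbf x_0}$ and mean function $\gamma(\mathbf x)=\mathsf E_{\mathbf x}\{\hat g(\mathbf y)\}$, $\mathbf x\in\mathcal X$. Let $\mathbf b=\partial\gamma(\mathbf x)/\partial\mathbf x|_{\mathbf x_0}$, and let $\mathbf J$ be the Fisher information matrix, $J_{k,l}=\mathsf E_{\mathbf x_0}\big\{\partial_{x_k}\log f(\mathbf y;\mathbf x)\,\partial_{x_l}\log f(\mathbf y;\mathbf x)\big|_{\mathbf x=\mathbf x_0}\big\}$, with Moore–Penrose pseudoinverse $\mathbf J^\dagger$. Then $\gamma$, $\mathbf b$ and $\mathbf J$ are well defined; $\gamma\in\mathcal H$; the functions $u_0=R(\cdot,\mathbf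 x_0)$ and $u_l=\partial R(\cdot,\mathbf x)/\partial x_l|_{\mathbf x=\mathbf x_0}$, $l=1,\dots,N$, exist and belong to $\mathcal H$; and, with $\mathcal U=\operatorname{span}\{u_0,u_1,\dots,u_N\}$ and $\gamma_{\mathcal U}$ the orthogonal projection of $\gamma$ onto $\mathcal U$, the Cramér–Rao bound coincides with the projection bound: $$v(\hat g;\mathbf x_0)\;\ge\;\|\gamma_{\mathcal U}\|_{\mathcal H}^2-\gamma(\mathbf x_0)^2\;=\;\mathbf b^T\mathbf J^\dagger\mathbf b .$$ -/

import Mathlib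

open MeasureTheory ProbabilityTheory Matrix

noncomputable section

/-! ### Moore–Penrose pseudoinverse of a real matrix -/

/-- The four Penrose equations: `B` is the Moore–Penrose pseudoinverse of `A`. -/
structure IsMoorePenrose {m n : ℕ} (A : Matrix (Fin m) (Fin n) ℝ)
    (B : Matrix (Fin n) (Fin m) ℝ) : Prop where
  mul_mul_self : A * B * A = A
  mul_mul_inv : B * A * B = B
  symm_left : (A * B)ᵀ = A * B
  symm_right : (B * A)ᵀ = B * A

theorem IsMoorePenrose.unique {m n : ℕ} {A : Matrix (Fin m) (Fin n) ℝ}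
    {B C : Matrix (Fin n) (Fin m) ℝ} (hB : IsMoorePenrose A B) (hC : IsMoorePenrose A C) :
    B = C := by
  have h1 : A * B = A * C := by
    calc A * B = (A * B)ᵀ := hB.symm_left.symm
      _ = (A * C * (A * B))ᵀ := by rw [← Matrix.mul_assoc, hC.mul_mul_self]
      _ = (A * B)ᵀ * (A * C)ᵀ := by rw [Matrix.transpose_mul]
      _ = A * B * (A * C) := by rw [hB.symm_left, hC.symm_left]
      _ = A * C := by rw [← Matrix.mul_assoc, hB.mul_mul_self]
  have h2 : B * A = C * A := by
    calc B * A = (B * A)ᵀ := hB.symm_right.symm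
      _ = (B * A * (C * A))ᵀ := by
        rw [Matrix.mul_assoc, ← Matrix.mul_assoc A, hC.mul_mul_self]
      _ = (C * A)ᵀ * (B * A)ᵀ := by rw [Matrix.transpose_mul]
      _ = C * A * (B * A) := by rw [hB.symm_right, hC.symm_right]
      _ = C * A := by rw [Matrix.mul_assoc, ← Matrix.mul_assoc A, hB.mul_mul_self]
  calc B = B * A * B := hB.mul_mul_inv.symm
    _ = C * A * B := by rw [h2]
    _ = C * (A * B) := Matrix.mul_assoc _ _ _
    _ = C * (A * C) := by rw [h1]
    _ = C * A * C := (Matrix.mul_assoc _ _ _).symm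
    _ = C := hC.mul_mul_inv

theorem exists_isMoorePenrose_of_symm {n : ℕ} (H : Matrix (Fin n) (Fin n) ℝ) (hH : Hᵀ = H) :
    ∃ B : Matrix (Fin n) (Fin n) ℝ, Bᵀ = B ∧ H * B = B * H ∧ IsMoorePenrose H B := by
  have hherm : H.IsHermitian := by
    rw [Matrix.IsHermitian, Matrix.conjTranspose_eq_transpose_of_trivial, hH]
  set U : Matrix (Fin n) (Fin n) ℝ := (hherm.eigenvectorUnitary : Matrix (Fin n) (Fin n) ℝ) with hU
  have hUU : Uᵀ * U = 1 := by
    have h := Unitary.coe_star_mul_self hherm.eigenvectorUnitary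
    rwa [Matrix.star_eq_conjTranspose, Matrix.conjTranspose_eq_transpose_of_trivial] at h
  have hspec : H = U * diagonal hherm.eigenvalues * Uᵀ := by
    have h := hherm.spectral_theorem
    rw [Unitary.conjStarAlgAut_apply, Matrix.star_eq_conjTranspose,
      Matrix.conjTranspose_eq_transpose_of_trivial] at h
    exact h
  have hmul : ∀ d e : Fin n → ℝ, (U * diagonal d * Uᵀ) * (U * diagonal e * Uᵀ)
      = U * diagonal (fun i => d i * e i) * Uᵀ := by
    intro d e
    calc (U * diagonal d * Uᵀ) * (U * diagonal e * Uᵀ)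
        = U * diagonal d * (Uᵀ * U) * diagonal e * Uᵀ := by simp only [Matrix.mul_assoc]
      _ = U * (diagonal d * diagonal e) * Uᵀ := by
        rw [hUU, Matrix.mul_one, Matrix.mul_assoc U]
      _ = _ := by rw [diagonal_mul_diagonal]
  have htr : ∀ d : Fin n → ℝ, (U * diagonal d * Uᵀ)ᵀ = U * diagonal d * Uᵀ := by
    intro d
    simp [Matrix.transpose_mul, Matrix.mul_assoc]
  generalize hherm.eigenvalues = d at hspec
  refine ⟨U * diagonal (fun i => (d i)⁻¹) * Uᵀ, htr _, ?_, ?_, ?_, ?_, ?_⟩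
  · rw [hspec, hmul, hmul]
    simp only [mul_comm]
  · rw [hspec, hmul, hmul]
    simp only [mul_inv_mul_cancel]
  · rw [hspec, hmul, hmul]
    congr 3
    funext i
    by_cases h : d i = 0 <;> simp [h]
  · rw [hspec, hmul, htr]
  · rw [hspec, hmul, htr]

theorem exists_isMoorePenrose {m n : ℕ} (A : Matrix (Fin m) (Fin n) ℝ) :
    ∃ B : Matrix (Fin n) (Fin m) ℝ, IsMoorePenrose A B := by
  obtain ⟨G, hG, hcomm, hMP⟩ := exists_isMoorePenrose_of_symm (Aᵀ * A) (by simp)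
  have key : A * (G * (Aᵀ * A)) = A := by
    have h0 : (A * (G * (Aᵀ * A)) - A)ᵀ * (A * (G * (Aᵀ * A)) - A) = 0 := by
      have h1 : Aᵀ * (A * (G * (Aᵀ * A)) - A) = 0 := by
        rw [Matrix.mul_sub, ← Matrix.mul_assoc, ← Matrix.mul_assoc, hMP.mul_mul_self, sub_self]
      have h2 : (A * (G * (Aᵀ * A)) - A)ᵀ = ((G * (Aᵀ * A))ᵀ - 1) * Aᵀ := by
        rw [Matrix.transpose_sub, Matrix.transpose_mul A, Matrix.sub_mul, Matrix.one_mul]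
      rw [h2, Matrix.mul_assoc, h1, Matrix.mul_zero]
    rw [← Matrix.conjTranspose_eq_transpose_of_trivial] at h0
    exact sub_eq_zero.mp (Matrix.conjTranspose_mul_self_eq_zero.mp h0)
  refine ⟨G * Aᵀ, ?_, ?_, ?_, ?_⟩
  · simpa only [Matrix.mul_assoc] using key
  · have h := hMP.mul_mul_inv
    calc G * Aᵀ * A * (G * Aᵀ) = (G * (Aᵀ * A) * G) * Aᵀ := by simp only [Matrix.mul_assoc]
      _ = G * Aᵀ := by rw [h]
  · simp [Matrix.transpose_mul, hG, Matrix.mul_assoc]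
  · have h := hMP.symm_right
    simpa only [Matrix.mul_assoc] using h

/-- The Moore–Penrose pseudoinverse `A†`. -/
def Matrix.pseudoinverse {m n : ℕ} (A : Matrix (Fin m) (Fin n) ℝ) : Matrix (Fin n) (Fin m) ℝ :=
  (exists_isMoorePenrose A).choose

theorem Matrix.isMoorePenrose_pseudoinverse {m n : ℕ} (A : Matrix (Fin m) (Fin n) ℝ) :
    IsMoorePenrose A A.pseudoinverse :=
  (exists_isMoorePenrose A).choose_spec

/-! ### Partial derivatives of multi-index order -/

/-- The `l`-th unit vector of `ℝ^N`. -/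
abbrev unitVec {N : ℕ} (l : Fin N) : EuclideanSpace ℝ (Fin N) := EuclideanSpace.single l 1

/-- The list of coordinates `[1, …, 1, 2, …, 2, …, N, …, N]`, where `k` occurs `p k` times. -/
def multiIndexList {N : ℕ} (p : Fin N → ℕ) : List (Fin N) :=
  (List.finRange N).flatMap fun k => List.replicate (p k) k

/-- Iterated partial derivative; the last coordinate of the list is differentiated first. -/
def iterPartial {N : ℕ} :
    List (Fin N) → (EuclideanSpace ℝ (Fin N) → ℝ) → EuclideanSpace ℝ (Fin N) → ℝ
  | [], F => F
  | k :: ks, F => fun x => lineDeriv ℝ (iterPartial ks F) x (unitVec k)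

/-- The iterated partial derivative exists at every point of `B` (used for open `B` only). -/
def IterPartialExistsOn {N : ℕ} :
    List (Fin N) → (EuclideanSpace ℝ (Fin N) → ℝ) → Set (EuclideanSpace ℝ (Fin N)) → Prop
  | [], _, _ => True
  | k :: ks, F, B => IterPartialExistsOn ks F B ∧
      ∀ x ∈ B, LineDifferentiableAt ℝ (iterPartial ks F) x (unitVec k)

/-- `∂^p F / ∂x^p = ∂^{p_1}/∂x_1^{p_1} ⋯ ∂^{p_N}/∂x_N^{p_N} F`. -/
def multiPartial {N : ℕ} (p : Fin N → ℕ) (F : EuclideanSpace ℝ (Fin N) → ℝ) :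
    EuclideanSpace ℝ (Fin N) → ℝ :=
  iterPartial (multiIndexList p) F

/-- `∂^p F / ∂x^p` exists at every point of `B` (used for open `B` only). -/
def MultiPartialExistsOn {N : ℕ} (p : Fin N → ℕ) (F : EuclideanSpace ℝ (Fin N) → ℝ)
    (B : Set (EuclideanSpace ℝ (Fin N))) : Prop :=
  IterPartialExistsOn (multiIndexList p) F B

/-! ### Estimation problems -/

/-- An estimation problem `(X, f(y; x), g)`: a parameter set `X ⊆ ℝ^N`, a statistical model given
by probability densities `f(·; x)`, `x ∈ X`, on `ℝ^M` with respect to a common dominating measure,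
and a real-valued parameter function `g` on `X`. The values `pdf x` at `x ∉ X` are irrelevant. -/
structure EstimationProblem (N M : ℕ) where
  paramSet : Set (EuclideanSpace ℝ (Fin N))
  base : Measure (EuclideanSpace ℝ (Fin M))
  pdf : EuclideanSpace ℝ (Fin N) → EuclideanSpace ℝ (Fin M) → ℝ
  paramFun : paramSet → ℝ
  pdf_measurable : ∀ x ∈ paramSet, Measurable (pdf x)
  pdf_nonneg : ∀ x ∈ paramSet, ∀ y, 0 ≤ pdf x y
  lintegral_pdf : ∀ x ∈ paramSet, ∫⁻ y, ENNReal.ofReal (pdf x y) ∂base = 1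

namespace EstimationProblem

variable {N M : ℕ}

/-- The distribution of the observation `y` under the parameter `x`. -/
def law (E : EstimationProblem N M) (x : EuclideanSpace ℝ (Fin N)) :
    Measure (EuclideanSpace ℝ (Fin M)) :=
  E.base.withDensity fun y => ENNReal.ofReal (E.pdf x y)

/-- The likelihood ratio `ρ(y, x) = f(y; x) / f(y; x₀)`, and `0` where `f(y; x₀) = 0`. -/
def likelihoodRatio (E : EstimationProblem N M) (x₀ x : EuclideanSpace ℝ (Fin N))
    (y : EuclideanSpace ℝ (Fin M)) : ℝ :=
  open Classical in if E.pdf x₀ y ≠ 0 then E.pdf x y / E.pdf x₀ y else 0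

/-- `E_{x₀} {ρ(y, x₁) ρ(y, x₂)}` is finite for all `x₁, x₂ ∈ X`. -/
def FiniteCorrelation (E : EstimationProblem N M) (x₀ : EuclideanSpace ℝ (Fin N)) : Prop :=
  ∀ x₁ ∈ E.paramSet, ∀ x₂ ∈ E.paramSet,
    Integrable (fun y => E.likelihoodRatio x₀ x₁ y * E.likelihoodRatio x₀ x₂ y) (E.law x₀)

/-- The kernel `R(x₁, x₂) = E_{x₀} {ρ(y, x₁) ρ(y, x₂)}`. -/
def kernel (E : EstimationProblem N M) (x₀ x₁ x₂ : EuclideanSpace ℝ (Fin N)) : ℝ :=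
  ∫ y, E.likelihoodRatio x₀ x₁ y * E.likelihoodRatio x₀ x₂ y ∂(E.law x₀)

/-- The kernel on `X × X`; the real number `R(x₁, x₂)` is regarded as an operator on `ℝ`. -/
def kernelMatrix (E : EstimationProblem N M) (x₀ : EuclideanSpace ℝ (Fin N)) :
    Matrix E.paramSet E.paramSet (ℝ →L[ℝ] ℝ) :=
  Matrix.of fun x₁ x₂ => E.kernel x₀ x₁ x₂ • ContinuousLinearMap.id ℝ ℝ

theorem posSemidef_kernelMatrix (E : EstimationProblem N M) (x₀ : EuclideanSpace ℝ (Fin N))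
    (h : E.FiniteCorrelation x₀) : (E.kernelMatrix x₀).PosSemidef := by
  have h3 := (RKHS.posSemidef_tfae (K := E.kernelMatrix x₀)).out 0 2
  refine h3.mpr ⟨?_, fun v => ?_⟩
  · ext x₁ x₂
    simp [kernelMatrix, kernel, mul_comm, star, Matrix.conjTranspose,
      ContinuousLinearMap.adjoint_id]
  · have key : (v.sum fun x w => v.sum fun x' w' =>
        inner ℝ (E.kernelMatrix x₀ x' x w) w') =
        ∫ y, (v.sum fun x w => w * E.likelihoodRatio x₀ x y) ^ 2 ∂(E.law x₀) := by
      simp only [Finsupp.sum, sq, Finset.sum_mul_sum]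
      rw [integral_finsetSum]
      · refine Finset.sum_congr rfl fun x _ => ?_
        rw [integral_finsetSum]
        · refine Finset.sum_congr rfl fun x' _ => ?_
          have : ∀ y, v x * E.likelihoodRatio x₀ x y * (v x' * E.likelihoodRatio x₀ x' y) =
              (v x * v x') * (E.likelihoodRatio x₀ x' y * E.likelihoodRatio x₀ x y) := by
            intro y; ring
          simp only [this, integral_const_mul]
          simp [kernelMatrix, kernel]
          ring
        · intro x' _
          convert! (h x x.2 x' x'.2).const_mul (v x * v x') using 2
          ring
      · intro x _
        refine integrable_finsetSum _ fun x' _ => ?_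
        convert! (h x x.2 x' x'.2).const_mul (v x * v x') using 2
        ring
    rw [key]
    exact integral_nonneg fun y => sq_nonneg _

instance (E : EstimationProblem N M) (x₀ : EuclideanSpace ℝ (Fin N))
    [h : Fact (E.FiniteCorrelation x₀)] : Fact (E.kernelMatrix x₀).PosSemidef :=
  ⟨E.posSemidef_kernelMatrix x₀ h.out⟩

/-- The reproducing kernel Hilbert space of functions on `X` with kernel `R`. -/
abbrev Space (E : EstimationProblem N M) (x₀ : EuclideanSpace ℝ (Fin N))
    [Fact (E.FiniteCorrelation x₀)] : Type :=
  RKHS.OfKernel (E.kernelMatrix x₀)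

/-- Regularity up to order `m` at `x₀`, for a problem satisfying `FiniteCorrelation` at `x₀`.
One radius `r` serves all the conditions. -/
def IsRegular (E : EstimationProblem N M) (m : ℕ) (x₀ : EuclideanSpace ℝ (Fin N)) : Prop :=
  ∃ r > 0, Metric.ball x₀ r ⊆ E.paramSet ∧
    -- the partial derivatives of the density exist and have finite weighted second moments
    (∀ p : Fin N → ℕ, (∀ k, p k ≤ m) →
      (∀ᵐ y ∂E.base, MultiPartialExistsOn p (fun x => E.pdf x y) (Metric.ball x₀ r)) ∧
      ∀ x ∈ Metric.ball x₀ r,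
        MemLp (fun y => 1 / E.pdf x₀ y * multiPartial p (fun x' => E.pdf x' y) x) 2 (E.law x₀)) ∧
    -- expectation commutes with partial differentiation, provided the right-hand side is finite
    (∀ h : EuclideanSpace ℝ (Fin M) → ℝ, Measurable h →
      (∀ x ∈ E.paramSet, Integrable h (E.law x)) →
      ∀ p : Fin N → ℕ, (∀ k, p k ≤ m) →
        (∀ x ∈ Metric.ball x₀ r,
          Integrable (fun y => h y * multiPartial p (fun x' => E.pdf x' y) x) E.base) →
        MultiPartialExistsOn p (fun x => ∫ y, h y * E.pdf x y ∂E.base) (Metric.ball x₀ r) ∧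
        ∀ x ∈ Metric.ball x₀ r,
          multiPartial p (fun x' => ∫ y, h y * E.pdf x' y ∂E.base) x =
            ∫ y, h y * multiPartial p (fun x' => E.pdf x' y) x ∂E.base) ∧
    -- the weighted correlations of the partial derivatives are continuous
    (∀ p₁ p₂ : Fin N → ℕ, (∀ k, p₁ k ≤ m) → (∀ k, p₂ k ≤ m) →
      ContinuousOn
        (fun z : EuclideanSpace ℝ (Fin N) × EuclideanSpace ℝ (Fin N) =>
          ∫ y, 1 / (E.pdf x₀ y) ^ 2 * multiPartial p₁ (fun x' => E.pdf x' y) z.1 *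
            multiPartial p₂ (fun x' => E.pdf x' y) z.2 ∂(E.law x₀))
        (Metric.ball x₀ r ×ˢ Metric.ball x₀ r))

/-- The linear span of `u₀` and `u_1, …, u_N`. -/
def spanFamily {H : Type*} [NormedAddCommGroup H] [InnerProductSpace ℝ H]
    (u₀ : H) (u : Fin N → H) : Submodule ℝ H :=
  Submodule.span ℝ (insert u₀ (Set.range u))

instance {H : Type*} [NormedAddCommGroup H] [InnerProductSpace ℝ H]
    (u₀ : H) (u : Fin N → H) : FiniteDimensional ℝ (spanFamily u₀ u) :=
  FiniteDimensional.span_of_finite ℝ ((Set.finite_range u).insert u₀)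

/-- The mean function `γ(x) = E_x {ĝ(y)}` of an estimator `ĝ`. -/
def mean (E : EstimationProblem N M) (ghat : EuclideanSpace ℝ (Fin M) → ℝ)
    (x : EuclideanSpace ℝ (Fin N)) : ℝ :=
  ∫ y, ghat y ∂(E.law x)

/-- `∂ log f(y; x) / ∂x_k` at `x = x₀`. -/
def score (E : EstimationProblem N M) (x₀ : EuclideanSpace ℝ (Fin N)) (k : Fin N)
    (y : EuclideanSpace ℝ (Fin M)) : ℝ :=
  lineDeriv ℝ (fun x => Real.log (E.pdf x y)) x₀ (unitVec k)

/-- The Fisher information matrix `J(x₀)`. -/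
def fisherInformation (E : EstimationProblem N M) (x₀ : EuclideanSpace ℝ (Fin N)) :
    Matrix (Fin N) (Fin N) ℝ :=
  Matrix.of fun k l => ∫ y, E.score x₀ k y * E.score x₀ l y ∂(E.law x₀)

/-- The gradient `b(x₀)` of the mean function of `ĝ`. -/
def meanGradient (E : EstimationProblem N M) (ghat : EuclideanSpace ℝ (Fin M) → ℝ)
    (x₀ : EuclideanSpace ℝ (Fin N)) : Fin N → ℝ :=
  fun l => lineDeriv ℝ (E.mean ghat) x₀ (unitVec l)

/-- The Cramér–Rao bound `bᵀ J† b`. -/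
def cramerRaoBound (E : EstimationProblem N M) (ghat : EuclideanSpace ℝ (Fin M) → ℝ)
    (x₀ : EuclideanSpace ℝ (Fin N)) : ℝ :=
  E.meanGradient ghat x₀ ⬝ᵥ
    ((E.fisherInformation x₀).pseudoinverse *ᵥ E.meanGradient ghat x₀)

end EstimationProblem

end

/-! Since `R(x₁, x₂)` is the inner product of `ρ(·, x₁)` and `ρ(·, x₂)` in `L²(P_{x₀})`, sending
`R(·, x)` to `ρ(·, x)` gives an isometry of the RKHS into `L²(P_{x₀})`. Its adjoint `T` is a
contraction with `(T g)(x) = ⟨ρ(·, x), g⟩ = E_x g` (`exists_coisometry`). Hence `T ĝ = γ`, `T ρ(·,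
x₀) = u₀` with `ρ(·, x₀) = 1` a.e., and `T` of the `l`-th score is `u_l`, by differentiation under
the expectation (`hasLineDerivAt_integral_law`).

`T` preserves inner products as soon as one argument is orthogonal to everything orthogonal to all
`ρ(·, x)`. The scores qualify: if `E_x h = 0` for all `x`, differentiating at `x₀` gives `⟨h, score⟩
= 0` (`inner_score_eq_zero_of_orthogonal`). So `u₀` is a unit vector orthogonal to the `u_l`, the
Gram matrix of the `u_l` is `J`, and `⟨u_l, γ⟩ = b_l`.

Finite-dimensional algebra then gives `‖γ_U‖² = γ(x₀)² + bᵀJ†b`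
(`norm_starProjection_spanFamily_sq`). The bound follows from `‖γ_U‖ ≤ ‖γ‖ ≤ ‖ĝ‖`. -/

/-! ### Hilbert space and matrix algebra -/

/-- Equal Gram matrices give corresponding finite combinations equal norms, so the map is well
defined and isometric on the span of `k`, and extends by density. -/
theorem exists_linearIsometry_of_inner_eq {X H L : Type*}
    [NormedAddCommGroup H] [InnerProductSpace ℝ H]
    [NormedAddCommGroup L] [InnerProductSpace ℝ L] [CompleteSpace L] (k : X → H) (ρ : X → L)
    (hk : (Submodule.span ℝ (Set.range k)).topologicalClosure = ⊤)
    (hinner : ∀ x y, inner ℝ (k x) (k y) = inner ℝ (ρ x) (ρ y)) :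
    ∃ S : H →ₗᵢ[ℝ] L, ∀ x, S (k x) = ρ x := by
  set e := Finsupp.linearCombination ℝ k
  set f := Finsupp.linearCombination ℝ ρ
  have hdense : DenseRange e := by
    have h := Submodule.dense_iff_topologicalClosure_eq_top.mpr hk
    rw [← Finsupp.range_linearCombination] at h
    exact h
  have hnorm : ∀ c, ‖f c‖ = ‖e c‖ := by
    intro c
    have h : inner ℝ (f c) (f c) = inner ℝ (e c) (e c) := by
      simp only [e, f, Finsupp.linearCombination_apply, Finsupp.sum_inner, Finsupp.inner_sum,
        inner_smul_left, inner_smul_right, hinner]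
    rw [real_inner_self_eq_norm_sq, real_inner_self_eq_norm_sq] at h
    exact (sq_eq_sq₀ (norm_nonneg _) (norm_nonneg _)).mp h
  have hbound : ∃ C, ∀ c, ‖f c‖ ≤ C * ‖e c‖ := ⟨1, fun c => by rw [one_mul, hnorm]⟩
  have heq : ∀ c, f.extendOfNorm e (e c) = f c := LinearMap.extendOfNorm_eq hdense hbound
  refine ⟨⟨(f.extendOfNorm e).toLinearMap, fun v => ?_⟩, fun x => ?_⟩
  · refine hdense.induction_on (p := fun v => ‖f.extendOfNorm e v‖ = ‖v‖) v
      (isClosed_eq (by fun_prop) (by fun_prop)) fun c => ?_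
    rw [heq, hnorm]
  · have h := heq (Finsupp.single x 1)
    simpa [e, f] using h

/-- The adjoint of the isometry which sends the family `k` to the family `ρ`. -/
theorem exists_continuousLinearMap_of_inner_eq {X H L : Type*}
    [NormedAddCommGroup H] [InnerProductSpace ℝ H] [CompleteSpace H]
    [NormedAddCommGroup L] [InnerProductSpace ℝ L] [CompleteSpace L] (k : X → H) (ρ : X → L)
    (hk : (Submodule.span ℝ (Set.range k)).topologicalClosure = ⊤)
    (hinner : ∀ x y, inner ℝ (k x) (k y) = inner ℝ (ρ x) (ρ y)) :
    ∃ T : L →L[ℝ] H, (∀ x g, inner ℝ (k x) (T g) = inner ℝ (ρ x) g) ∧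
      (∀ g, ‖T g‖ ≤ ‖g‖) ∧
      ∀ s, (∀ h, (∀ x, inner ℝ (ρ x) h = 0) → inner ℝ h s = 0) →
        ∀ g, inner ℝ (T s) (T g) = inner ℝ s g := by
  obtain ⟨S, hS⟩ := exists_linearIsometry_of_inner_eq k ρ hk hinner
  set T := ContinuousLinearMap.adjoint S.toContinuousLinearMap
  have hT : ∀ v g, inner ℝ v (T g) = inner ℝ (S v) g := fun v g =>
    ContinuousLinearMap.adjoint_inner_right _ _ _
  have hTS : ∀ v, T (S v) = v := fun v =>
    ext_inner_left ℝ fun w => by rw [hT, S.inner_map_map]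
  have hTρ : ∀ x g, inner ℝ (k x) (T g) = inner ℝ (ρ x) g := fun x g => by rw [hT, hS]
  refine ⟨T, hTρ, fun g => ?_, fun s hs g => ?_⟩
  · have h1 : ‖T g‖ * ‖T g‖ ≤ ‖T g‖ * ‖g‖ := by
      calc ‖T g‖ * ‖T g‖ = inner ℝ (S (T g)) g := by rw [← hT, real_inner_self_eq_norm_mul_norm]
        _ ≤ ‖S (T g)‖ * ‖g‖ := real_inner_le_norm _ _
        _ = ‖T g‖ * ‖g‖ := by rw [S.norm_map]
    by_cases h0 : ‖T g‖ = 0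
    · rw [h0]; exact norm_nonneg g
    · exact le_of_mul_le_mul_left h1 (lt_of_le_of_ne (norm_nonneg _) (Ne.symm h0))
  -- The defect `S (T s) - s` lies in `ker T`, so it is orthogonal to every `ρ x`, hence to `s`, and
  -- also to the range of `S`. It is therefore orthogonal to itself, and `s = S (T s)`.
  · have h0 : T (S (T s) - s) = 0 := by rw [map_sub, hTS, sub_self]
    have h1 : inner ℝ (S (T s) - s) s = 0 := hs _ fun x => by rw [← hTρ, h0, inner_zero_right]
    have h2 : inner ℝ (S (T s) - s) (S (T s)) = 0 := by
      rw [real_inner_comm, ← hT, h0, inner_zero_right]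
    have h3 : S (T s) - s = 0 := by
      rw [← inner_self_eq_zero (𝕜 := ℝ), inner_sub_right, h1, h2, sub_zero]
    rw [hT, sub_eq_zero.mp h3]

/-- For symmetric `J`, the range is the orthogonal complement of the kernel, and `J J†` is the
orthogonal projection onto it. -/
theorem Matrix.mul_pseudoinverse_mulVec_of_ker_le {n : ℕ} {J : Matrix (Fin n) (Fin n) ℝ}
    (hJ : Jᵀ = J) {b : Fin n → ℝ} (hb : ∀ w, J *ᵥ w = 0 → w ⬝ᵥ b = 0) :
    J *ᵥ (J.pseudoinverse *ᵥ b) = b := by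
  have hMP := J.isMoorePenrose_pseudoinverse
  set P := J * J.pseudoinverse
  have hJP : J * P = J := by
    calc J * P = (P * J)ᵀ := by rw [transpose_mul, hJ, hMP.symm_left]
      _ = J := by rw [hMP.mul_mul_self, hJ]
  have hw : J *ᵥ (b - P *ᵥ b) = 0 := by
    rw [mulVec_sub, mulVec_mulVec, hJP, sub_self]
  have h1 := hb _ hw
  have h2 : (b - P *ᵥ b) ⬝ᵥ (P *ᵥ b) = 0 := by
    have h : ∀ v, (b - P *ᵥ b) ⬝ᵥ (J *ᵥ v) = 0 := fun v => by
      rw [dotProduct_mulVec, ← mulVec_transpose, hJ, hw, zero_dotProduct]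
    have h' := h (J.pseudoinverse *ᵥ b)
    rwa [mulVec_mulVec] at h'
  have h3 : (b - P *ᵥ b) ⬝ᵥ (b - P *ᵥ b) = 0 := by rw [dotProduct_sub, h1, h2, sub_zero]
  rw [mulVec_mulVec]
  exact (sub_eq_zero.mp (dotProduct_self_eq_zero.mp h3)).symm

namespace EstimationProblem

/-- The projection is `⟨u₀, γ⟩ u₀ + ∑ a_l u_l`, where `a` solves the normal equations `J a = b`. The
`u_l` may be linearly dependent, and `a = J† b` is still a solution. -/
theorem norm_starProjection_spanFamily_sq {N : ℕ} {H : Type*} [NormedAddCommGroup H]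
    [InnerProductSpace ℝ H] {u₀ γ : H} {u : Fin N → H} {J : Matrix (Fin N) (Fin N) ℝ}
    {b : Fin N → ℝ} (h₀ : inner ℝ u₀ u₀ = 1) (h₁ : ∀ l, inner ℝ u₀ (u l) = 0)
    (hJ : ∀ k l, inner ℝ (u k) (u l) = J k l) (hb : ∀ l, inner ℝ (u l) γ = b l) :
    ‖(spanFamily u₀ u).starProjection γ‖ ^ 2 =
      inner ℝ u₀ γ ^ 2 + b ⬝ᵥ (J.pseudoinverse *ᵥ b) := by
  have hsymm : Jᵀ = J := by
    ext k l
    rw [transpose_apply, ← hJ, ← hJ, real_inner_comm]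
  have hinner : ∀ (a : Fin N → ℝ) k, inner ℝ (u k) (∑ l, a l • u l) = (J *ᵥ a) k := by
    intro a k
    simp only [inner_sum, inner_smul_right, hJ, mulVec, dotProduct, mul_comm]
  -- A kernel vector of the Gram matrix is a linear relation among the `u_l`; pairing the relation
  -- with `γ` gives `w · b = 0`.
  have hker : ∀ w, J *ᵥ w = 0 → w ⬝ᵥ b = 0 := by
    intro w hw
    have h : ∑ l, w l • u l = 0 := by
      rw [← inner_self_eq_zero (𝕜 := ℝ), sum_inner]
      simp [inner_smul_left, hinner, hw]
    calc w ⬝ᵥ b = inner ℝ (∑ l, w l • u l) γ := by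
          simp [sum_inner, inner_smul_left, hb, dotProduct]
      _ = 0 := by rw [h, inner_zero_left]
  set a := J.pseudoinverse *ᵥ b
  have hJa : J *ᵥ a = b := mul_pseudoinverse_mulVec_of_ker_le hsymm hker
  set c : ℝ := inner ℝ u₀ γ
  have hmem₀ : u₀ ∈ spanFamily u₀ u := Submodule.subset_span (Set.mem_insert _ _)
  have hmem : ∀ l, u l ∈ spanFamily u₀ u := fun l =>
    Submodule.subset_span (Set.mem_insert_of_mem _ (Set.mem_range_self l))
  have horth₀ : inner ℝ u₀ (∑ l, a l • u l) = 0 := by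
    simp [inner_sum, inner_smul_right, h₁]
  have hproj : (spanFamily u₀ u).starProjection γ = c • u₀ + ∑ l, a l • u l := by
    refine Submodule.eq_starProjection_of_mem_of_inner_eq_zero
      (Submodule.add_mem _ (Submodule.smul_mem _ _ hmem₀)
        (Submodule.sum_mem _ fun l _ => Submodule.smul_mem _ _ (hmem l))) fun w hw => ?_
    induction hw using Submodule.span_induction with
    | mem x hx =>
      rw [real_inner_comm, inner_sub_right, inner_add_right, inner_smul_right]
      rcases hx with rfl | ⟨l, rfl⟩
      · rw [h₀, horth₀]; simp [c]
      · rw [hinner, hJa, hb, real_inner_comm, h₁]; simp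
    | zero => exact inner_zero_right _
    | add x y _ _ hx hy => rw [inner_add_right, hx, hy, add_zero]
    | smul r x _ hx => rw [inner_smul_right, hx, mul_zero]
  rw [hproj, ← real_inner_self_eq_norm_sq]
  have h2 : inner ℝ (∑ l, a l • u l) (∑ l, a l • u l) = b ⬝ᵥ a := by
    rw [sum_inner]
    simp only [inner_smul_left, hinner, hJa, dotProduct, mul_comm, conj_trivial]
  rw [real_inner_add_add_self, inner_smul_left, inner_smul_right, inner_smul_left, h₀, horth₀, h2]
  simp [sq]

end EstimationProblem

/-! ### Multi-index derivatives of order one as line derivatives -/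

theorem multiIndexList_single {N : ℕ} (l : Fin N) : multiIndexList (Pi.single l 1) = [l] := by
  have h : ∀ L : List (Fin N),
      (L.flatMap fun k => List.replicate ((Pi.single l 1 : Fin N → ℕ) k) k) =
        List.replicate (L.count l) l := by
    intro L
    induction L with
    | nil => rfl
    | cons a L ih =>
      rw [List.flatMap_cons, ih, List.count_cons]
      by_cases ha : a = l
      · subst ha
        simp [List.replicate_succ]
      · simp [ha]
  rw [multiIndexList, h, List.count_eq_one_of_mem (List.nodup_finRange N) (List.mem_finRange l)]
  rfl

theorem single_one_le_one {N : ℕ} (l k : Fin N) : (Pi.single l 1 : Fin N → ℕ) k ≤ 1 := by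
  by_cases hk : k = l <;> simp [hk]

theorem multiPartial_single {N : ℕ} (l : Fin N) (F : EuclideanSpace ℝ (Fin N) → ℝ) :
    multiPartial (Pi.single l 1) F = fun x => lineDeriv ℝ F x (unitVec l) := by
  rw [multiPartial, multiIndexList_single]
  rfl

theorem multiPartialExistsOn_single_iff {N : ℕ} {l : Fin N} {F : EuclideanSpace ℝ (Fin N) → ℝ}
    {B : Set (EuclideanSpace ℝ (Fin N))} :
    MultiPartialExistsOn (Pi.single l 1) F B ↔
      ∀ x ∈ B, LineDifferentiableAt ℝ F x (unitVec l) := by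
  rw [MultiPartialExistsOn, multiIndexList_single]
  simp [IterPartialExistsOn, iterPartial]

/-! ### Change of measure to the law at `x₀` -/

namespace EstimationProblem

variable {N M : ℕ} {E : EstimationProblem N M} {x₀ x : EuclideanSpace ℝ (Fin N)}
  {h : EuclideanSpace ℝ (Fin M) → ℝ}

theorem integrable_law_iff (hx : x ∈ E.paramSet) :
    Integrable h (E.law x) ↔ Integrable (fun y => h y * E.pdf x y) E.base := by
  rw [law, integrable_withDensity_iff (E.pdf_measurable x hx).ennreal_ofReal (by simp)]
  simp only [ENNReal.toReal_ofReal (E.pdf_nonneg x hx _)]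

theorem integral_law (hx : x ∈ E.paramSet) (h : EuclideanSpace ℝ (Fin M) → ℝ) :
    ∫ y, h y ∂(E.law x) = ∫ y, h y * E.pdf x y ∂E.base := by
  rw [law, integral_withDensity_eq_integral_toReal_smul
    (E.pdf_measurable x hx).ennreal_ofReal (by simp)]
  simp only [ENNReal.toReal_ofReal (E.pdf_nonneg x hx _), smul_eq_mul, mul_comm]

theorem isProbabilityMeasure_law (hx : x ∈ E.paramSet) : IsProbabilityMeasure (E.law x) :=
  ⟨by rw [law, withDensity_apply _ MeasurableSet.univ, Measure.restrict_univ,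
    E.lintegral_pdf x hx]⟩

theorem ae_law_of_ae_base {p : EuclideanSpace ℝ (Fin M) → Prop} (hp : ∀ᵐ y ∂E.base, p y) :
    ∀ᵐ y ∂(E.law x), p y :=
  (withDensity_absolutelyContinuous _ _).ae_le hp

theorem measurable_likelihoodRatio (hx₀ : x₀ ∈ E.paramSet) (hx : x ∈ E.paramSet) :
    Measurable (E.likelihoodRatio x₀ x) := by
  classical
  have h : E.likelihoodRatio x₀ x = fun y => E.pdf x y / E.pdf x₀ y := by
    funext y
    by_cases hy : E.pdf x₀ y = 0 <;> simp [likelihoodRatio, hy]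
  rw [h]
  exact (E.pdf_measurable x hx).div (E.pdf_measurable x₀ hx₀)

theorem memLp_likelihoodRatio (hfin : E.FiniteCorrelation x₀) (hx₀ : x₀ ∈ E.paramSet)
    (hx : x ∈ E.paramSet) : MemLp (E.likelihoodRatio x₀ x) 2 (E.law x₀) := by
  rw [memLp_two_iff_integrable_sq (measurable_likelihoodRatio hx₀ hx).aestronglyMeasurable]
  simpa only [sq] using hfin x hx x hx

/-- As `f(·; x₀)` vanishes only on a null set, `ρ(·, x)` is the density of `P_x` with respect to
`P_{x₀}`. -/
theorem mul_pdf_ae_eq_mul_likelihoodRatio_mul_pdf (hpos : ∀ᵐ y ∂E.base, E.pdf x₀ y ≠ 0)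
    (h : EuclideanSpace ℝ (Fin M) → ℝ) (x : EuclideanSpace ℝ (Fin N)) :
    (fun y => h y * E.pdf x y) =ᵐ[E.base]
      fun y => h y * E.likelihoodRatio x₀ x y * E.pdf x₀ y := by
  filter_upwards [hpos] with y hy
  rw [likelihoodRatio, if_pos hy, mul_assoc, div_mul_cancel₀ _ hy]

theorem integrable_law_iff_mul_likelihoodRatio (hpos : ∀ᵐ y ∂E.base, E.pdf x₀ y ≠ 0)
    (hx₀ : x₀ ∈ E.paramSet) (hx : x ∈ E.paramSet) :
    Integrable h (E.law x) ↔ Integrable (fun y => h y * E.likelihoodRatio x₀ x y) (E.law x₀) := by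
  rw [integrable_law_iff hx, integrable_law_iff hx₀]
  exact integrable_congr (mul_pdf_ae_eq_mul_likelihoodRatio_mul_pdf hpos h x)

theorem integral_law_eq_mul_likelihoodRatio (hpos : ∀ᵐ y ∂E.base, E.pdf x₀ y ≠ 0)
    (hx₀ : x₀ ∈ E.paramSet) (hx : x ∈ E.paramSet) (h : EuclideanSpace ℝ (Fin M) → ℝ) :
    ∫ y, h y ∂(E.law x) = ∫ y, h y * E.likelihoodRatio x₀ x y ∂(E.law x₀) := by
  rw [integral_law hx, integral_law hx₀]
  exact integral_congr_ae (mul_pdf_ae_eq_mul_likelihoodRatio_mul_pdf hpos h x)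

theorem integrable_law_of_memLp (hpos : ∀ᵐ y ∂E.base, E.pdf x₀ y ≠ 0)
    (hfin : E.FiniteCorrelation x₀) (hx₀ : x₀ ∈ E.paramSet) (hh : MemLp h 2 (E.law x₀))
    (hx : x ∈ E.paramSet) : Integrable h (E.law x) :=
  (integrable_law_iff_mul_likelihoodRatio hpos hx₀ hx).mpr
    (hh.integrable_mul (memLp_likelihoodRatio hfin hx₀ hx))

theorem likelihoodRatio_self_ae_eq_one (hpos : ∀ᵐ y ∂E.base, E.pdf x₀ y ≠ 0) :
    E.likelihoodRatio x₀ x₀ =ᵐ[E.law x₀] fun _ => 1 := by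
  filter_upwards [ae_law_of_ae_base hpos] with y hy
  rw [likelihoodRatio, if_pos hy, div_self hy]

/-! ### The score and differentiation under the expectation -/

theorem ae_hasLineDerivAt_pdf (hreg : E.IsRegular 1 x₀) :
    ∀ᵐ y ∂E.base, ∀ l : Fin N, HasLineDerivAt ℝ (fun x => E.pdf x y)
      (lineDeriv ℝ (fun x => E.pdf x y) x₀ (unitVec l)) x₀ (unitVec l) := by
  obtain ⟨r, hr, -, hdiff, -, -⟩ := hreg
  refine ae_all_iff.mpr fun l => ?_
  filter_upwards [(hdiff _ (single_one_le_one l)).1] with y hy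
  exact (multiPartialExistsOn_single_iff.mp hy x₀ (Metric.mem_ball_self hr)).hasLineDerivAt

theorem ae_hasLineDerivAt_log_pdf (hpos : ∀ᵐ y ∂E.base, E.pdf x₀ y ≠ 0)
    (hreg : E.IsRegular 1 x₀) :
    ∀ᵐ y ∂E.base, ∀ l : Fin N, HasLineDerivAt ℝ (fun x => Real.log (E.pdf x y))
      (1 / E.pdf x₀ y * lineDeriv ℝ (fun x => E.pdf x y) x₀ (unitVec l)) x₀ (unitVec l) := by
  filter_upwards [hpos, ae_hasLineDerivAt_pdf hreg] with y hy hdiff l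
  have h := HasDerivAt.log (hdiff l) (by simpa using hy)
  simpa [HasLineDerivAt, div_eq_inv_mul] using h

theorem score_ae_eq (hpos : ∀ᵐ y ∂E.base, E.pdf x₀ y ≠ 0) (hreg : E.IsRegular 1 x₀) (l : Fin N) :
    E.score x₀ l =ᵐ[E.base]
      fun y => 1 / E.pdf x₀ y * lineDeriv ℝ (fun x => E.pdf x y) x₀ (unitVec l) := by
  filter_upwards [ae_hasLineDerivAt_log_pdf hpos hreg] with y hy
  exact (hy l).lineDeriv

theorem memLp_score (hpos : ∀ᵐ y ∂E.base, E.pdf x₀ y ≠ 0) (hreg : E.IsRegular 1 x₀) (l : Fin N) :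
    MemLp (E.score x₀ l) 2 (E.law x₀) := by
  refine (memLp_congr_ae (ae_law_of_ae_base (score_ae_eq hpos hreg l))).mpr ?_
  obtain ⟨r, hr, -, hdiff, -, -⟩ := hreg
  have h := (hdiff _ (single_one_le_one l)).2 x₀ (Metric.mem_ball_self hr)
  simpa only [multiPartial_single] using h

/-- Differentiation under the expectation, for statistics with finite second moment. -/
theorem hasLineDerivAt_integral_law (hpos : ∀ᵐ y ∂E.base, E.pdf x₀ y ≠ 0)
    (hfin : E.FiniteCorrelation x₀) (hreg : E.IsRegular 1 x₀) (hx₀ : x₀ ∈ E.paramSet)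
    (hmeas : Measurable h) (hh : MemLp h 2 (E.law x₀)) (l : Fin N) :
    HasLineDerivAt ℝ (fun x => ∫ y, h y ∂(E.law x)) (∫ y, h y * E.score x₀ l y ∂(E.law x₀))
      x₀ (unitVec l) := by
  have hscore := score_ae_eq hpos hreg l
  obtain ⟨r, hr, hball, hdiff, hinter, -⟩ := hreg
  have hl := single_one_le_one l
  have hae : ∀ x, (fun y => h y * (1 / E.pdf x₀ y *
        lineDeriv ℝ (fun x' => E.pdf x' y) x (unitVec l)) * E.pdf x₀ y) =ᵐ[E.base]
      fun y => h y * lineDeriv ℝ (fun x' => E.pdf x' y) x (unitVec l) := by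
    intro x
    filter_upwards [hpos] with y hy
    field_simp
  have hint : ∀ x ∈ Metric.ball x₀ r, Integrable
      (fun y => h y * multiPartial (Pi.single l 1) (fun x' => E.pdf x' y) x) E.base := by
    intro x hx
    -- A product of two `L²(P_{x₀})` functions is integrable, which supplies the finiteness
    -- condition of the interchange rule on the whole ball.
    have h1 := hh.integrable_mul ((hdiff _ hl).2 x hx)
    simp only [multiPartial_single] at h1 ⊢
    exact (integrable_congr (hae x)).mp ((integrable_law_iff hx₀).mp h1)
  obtain ⟨hex, heq⟩ := hinter h hmeas (fun x hx => integrable_law_of_memLp hpos hfin hx₀ hh hx)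
    _ hl hint
  have hd := (multiPartialExistsOn_single_iff.mp hex x₀ (Metric.mem_ball_self hr)).hasLineDerivAt
  have heq₀ := heq x₀ (Metric.mem_ball_self hr)
  simp only [multiPartial_single] at heq₀
  rw [heq₀] at hd
  have hval : ∫ y, h y * E.score x₀ l y ∂(E.law x₀) =
      ∫ y, h y * lineDeriv ℝ (fun x' => E.pdf x' y) x₀ (unitVec l) ∂E.base := by
    rw [integral_law hx₀]
    refine integral_congr_ae (Filter.EventuallyEq.trans ?_ (hae x₀))
    filter_upwards [hscore] with y hy
    rw [hy]
  rw [hval]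
  refine hd.congr_of_eventuallyEq ?_
  -- Outside the parameter set `pdf x` need not be a density, so the two forms of the expectation
  -- are compared only near `x₀`.
  filter_upwards [Metric.ball_mem_nhds x₀ hr] with x hx
  exact integral_law (hball hx) h

end EstimationProblem

theorem MeasureTheory.MemLp.inner_toLp_toLp {α : Type*} [MeasurableSpace α] {μ : Measure α}
    {f g : α → ℝ} (hf : MemLp f 2 μ) (hg : MemLp g 2 μ) :
    inner ℝ (hf.toLp f) (hg.toLp g) = ∫ y, f y * g y ∂μ := by
  rw [L2.inner_def]
  refine integral_congr_ae ?_
  filter_upwards [hf.coeFn_toLp, hg.coeFn_toLp] with y hy hy'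
  rw [hy, hy']
  simp [mul_comm]

/-! ### The coisometry from `L²` and the scores -/

namespace EstimationProblem

variable {N M : ℕ} {E : EstimationProblem N M} {x₀ x : EuclideanSpace ℝ (Fin N)}

theorem Space.kerFun_apply (x x' : E.paramSet) [Fact (E.FiniteCorrelation x₀)] :
    RKHS.kerFun (E.Space x₀) x (1 : ℝ) x' = E.kernel x₀ x' x := by
  rw [RKHS.kerFun_apply, RKHS.OfKernel.kernel_ofKernel]
  simp [kernelMatrix]

/-- The values are scalars, so each kernel function is a multiple of the one with vector `1`. -/
theorem Space.topologicalClosure_span_kerFun [Fact (E.FiniteCorrelation x₀)] :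
    (Submodule.span ℝ (Set.range fun x : E.paramSet =>
      RKHS.kerFun (E.Space x₀) x (1 : ℝ))).topologicalClosure = ⊤ := by
  refine top_unique ((RKHS.kerFun_dense (E.Space x₀)).ge.trans
    (Submodule.topologicalClosure_mono (Submodule.span_le.mpr ?_)))
  rintro _ ⟨x, v, rfl⟩
  have h : RKHS.kerFun (E.Space x₀) x v = v • RKHS.kerFun (E.Space x₀) x (1 : ℝ) := by
    rw [← map_smul, smul_eq_mul, mul_one]
  rw [h]
  exact Submodule.smul_mem _ _ (Submodule.subset_span ⟨x, rfl⟩)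

/-- The coisometry from `L²(P_{x₀})` onto the reproducing kernel Hilbert space. -/
theorem exists_coisometry [hfin : Fact (E.FiniteCorrelation x₀)] (hx₀ : x₀ ∈ E.paramSet) :
    ∃ T : Lp ℝ 2 (E.law x₀) →L[ℝ] E.Space x₀,
      (∀ g (x : E.paramSet), T g x =
        inner ℝ ((memLp_likelihoodRatio hfin.out hx₀ x.2).toLp _) g) ∧
      (∀ g, ‖T g‖ ≤ ‖g‖) ∧
      ∀ s, (∀ h : Lp ℝ 2 (E.law x₀), (∀ x : E.paramSet,
          inner ℝ ((memLp_likelihoodRatio hfin.out hx₀ x.2).toLp _) h = 0) → inner ℝ h s = 0) →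
        ∀ g, inner ℝ (T s) (T g) = inner ℝ s g := by
  obtain ⟨T, h1, h2, h3⟩ := exists_continuousLinearMap_of_inner_eq
    (fun x : E.paramSet => RKHS.kerFun (E.Space x₀) x (1 : ℝ))
    (fun x : E.paramSet => (memLp_likelihoodRatio hfin.out hx₀ x.2).toLp _)
    Space.topologicalClosure_span_kerFun (fun x x' => by
      rw [RKHS.kerFun_inner, Space.kerFun_apply, MemLp.inner_toLp_toLp]
      simp [kernel])
  refine ⟨T, fun g x => ?_, h2, h3⟩
  rw [← h1, RKHS.kerFun_inner]
  simp

/-- The integral is the derivative at `x₀` of an expectation that is constant near `x₀`. The case `c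
= 0` places the scores in the closed span of the likelihood ratios; `h = 1`, `c = 1` shows that they
have mean zero. -/
theorem integral_score_mul_eq_zero (hpos : ∀ᵐ y ∂E.base, E.pdf x₀ y ≠ 0)
    (hfin : E.FiniteCorrelation x₀) (hreg : E.IsRegular 1 x₀) (hx₀ : x₀ ∈ interior E.paramSet)
    {h : EuclideanSpace ℝ (Fin M) → ℝ} (hmeas : Measurable h) (hh : MemLp h 2 (E.law x₀)) {c : ℝ}
    (hc : ∀ x ∈ E.paramSet, ∫ y, h y ∂(E.law x) = c) (l : Fin N) :
    ∫ y, h y * E.score x₀ l y ∂(E.law x₀) = 0 := by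
  have h1 := hasLineDerivAt_integral_law hpos hfin hreg (interior_subset hx₀) hmeas hh l
  have h2 : HasLineDerivAt ℝ (fun _ : EuclideanSpace ℝ (Fin N) => c) 0 x₀ (unitVec l) :=
    hasDerivAt_const _ _
  refine h1.unique (h2.congr_of_eventuallyEq ?_)
  filter_upwards [mem_interior_iff_mem_nhds.mp hx₀] with x hx
  exact hc x hx

/-- Orthogonality to every `ρ(·, x)` means `E_x h = 0` for all `x`. No limit of difference quotients
in `L²` is needed. -/
theorem inner_score_eq_zero_of_orthogonal (hpos : ∀ᵐ y ∂E.base, E.pdf x₀ y ≠ 0)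
    (hfin : E.FiniteCorrelation x₀) (hreg : E.IsRegular 1 x₀) (hx₀ : x₀ ∈ interior E.paramSet)
    {h : Lp ℝ 2 (E.law x₀)} (hh : ∀ x : E.paramSet,
      inner ℝ ((memLp_likelihoodRatio hfin (interior_subset hx₀) x.2).toLp _) h = 0) (l : Fin N) :
    inner ℝ h ((memLp_score hpos hreg l).toLp _) = 0 := by
  have hLp := Lp.memLp h
  have hself : h = hLp.toLp _ := (Lp.toLp_coeFn h hLp).symm
  rw [hself, MemLp.inner_toLp_toLp]
  refine integral_score_mul_eq_zero hpos hfin hreg hx₀ (Lp.stronglyMeasurable h).measurable hLp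
    (c := 0) (fun x hx => ?_) l
  rw [integral_law_eq_mul_likelihoodRatio hpos (interior_subset hx₀) hx]
  have h1 := hh ⟨x, hx⟩
  rw [hself, MemLp.inner_toLp_toLp] at h1
  simpa only [mul_comm] using h1

end EstimationProblem

/-! ### The Cramér–Rao bound as a projection bound -/

open EstimationProblem

theorem theorem1 {N M : ℕ} (E : EstimationProblem N M) (x₀ : EuclideanSpace ℝ (Fin N))
    (hx₀ : x₀ ∈ interior E.paramSet)
    (hpos : ∀ᵐ y ∂E.base, E.pdf x₀ y ≠ 0)
    [Fact (E.FiniteCorrelation x₀)]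
    (hreg : E.IsRegular 1 x₀)
    (ghat : EuclideanSpace ℝ (Fin M) → ℝ) (hmeas : Measurable ghat)
    (hvar : evariance ghat (E.law x₀) < ⊤) :
    -- the mean function, its gradient and the Fisher information are well defined
    (∀ x ∈ E.paramSet, Integrable ghat (E.law x)) ∧
    (∀ l, LineDifferentiableAt ℝ (E.mean ghat) x₀ (unitVec l)) ∧
    (∀ᵐ y ∂(E.law x₀), ∀ l,
      LineDifferentiableAt ℝ (fun x => Real.log (E.pdf x y)) x₀ (unitVec l)) ∧
    (∀ k l, Integrable (fun y => E.score x₀ k y * E.score x₀ l y) (E.law x₀)) ∧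
    -- `R(·, x₀)`, its partial derivatives and the mean function are elements of the RKHS
    ∃ (u₀ : E.Space x₀) (u : Fin N → E.Space x₀) (γ : E.Space x₀),
      (∀ x' : E.paramSet, u₀ x' = E.kernel x₀ x' x₀) ∧
      (∀ l, ∀ x' : E.paramSet,
        HasLineDerivAt ℝ (fun x => E.kernel x₀ x' x) (u l x') x₀ (unitVec l)) ∧
      (∀ x' : E.paramSet, γ x' = E.mean ghat x') ∧
      -- the projection bound for their span is the Cramér–Rao bound
      ‖(EstimationProblem.spanFamily u₀ u).starProjection γ‖ ^ 2 - E.mean ghat x₀ ^ 2 =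
        E.cramerRaoBound ghat x₀ ∧
      E.cramerRaoBound ghat x₀ ≤ variance ghat (E.law x₀) := by
  have hfin : E.FiniteCorrelation x₀ := Fact.out
  have hx : x₀ ∈ E.paramSet := interior_subset hx₀
  have hprob : IsProbabilityMeasure (E.law x₀) := isProbabilityMeasure_law hx
  have hg : MemLp ghat 2 (E.law x₀) :=
    (evariance_lt_top_iff_memLp hmeas.aestronglyMeasurable).mp hvar
  have hs := memLp_score hpos hreg
  have hρ : ∀ x : E.paramSet, MemLp (E.likelihoodRatio x₀ x) 2 (E.law x₀) := fun x =>
    memLp_likelihoodRatio hfin hx x.2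
  have hmean : ∀ l, HasLineDerivAt ℝ (E.mean ghat) (∫ y, ghat y * E.score x₀ l y ∂(E.law x₀))
      x₀ (unitVec l) := hasLineDerivAt_integral_law hpos hfin hreg hx hmeas hg
  refine ⟨fun x => integrable_law_of_memLp hpos hfin hx hg, fun l => (hmean l).lineDifferentiableAt,
    (ae_law_of_ae_base (ae_hasLineDerivAt_log_pdf hpos hreg)).mono fun y hy l =>
      (hy l).lineDifferentiableAt, fun k l => (hs k).integrable_mul (hs l), ?_⟩
  obtain ⟨T, hT, hTle, hTinner⟩ := exists_coisometry (E := E) hx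
  set e : E.paramSet := ⟨x₀, hx⟩
  set u₀ := T ((hρ e).toLp _)
  set u : Fin N → E.Space x₀ := fun l => T ((hs l).toLp _)
  set γ := T (hg.toLp _)
  have hone : ∀ (f : EuclideanSpace ℝ (Fin M) → ℝ),
      ∫ y, E.likelihoodRatio x₀ e y * f y ∂(E.law x₀) = ∫ y, f y ∂(E.law x₀) := fun f => by
    refine integral_congr_ae ?_
    filter_upwards [likelihoodRatio_self_ae_eq_one hpos] with y hy
    rw [hy, one_mul]
  -- `ρ(·, x₀)` belongs to the family itself, so the orthogonality condition is immediate.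
  have hinner₀ : ∀ g, inner ℝ u₀ (T g) = inner ℝ ((hρ e).toLp _) g :=
    hTinner _ fun h hh => by rw [real_inner_comm]; exact hh e
  have hinner : ∀ l g, inner ℝ (u l) (T g) = inner ℝ ((hs l).toLp _) g := fun l =>
    hTinner _ fun h hh => inner_score_eq_zero_of_orthogonal hpos hfin hreg hx₀ hh l
  have hu₀γ : inner ℝ u₀ γ = E.mean ghat x₀ := by
    rw [hinner₀, MemLp.inner_toLp_toLp, hone, mean]
  have hproj : ‖(spanFamily u₀ u).starProjection γ‖ ^ 2 - E.mean ghat x₀ ^ 2 =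
      E.cramerRaoBound ghat x₀ := by
    have h := norm_starProjection_spanFamily_sq (u₀ := u₀) (u := u) (γ := γ)
      (J := E.fisherInformation x₀) (b := E.meanGradient ghat x₀) ?_ ?_ ?_ ?_
    · rw [h, hu₀γ, cramerRaoBound, add_sub_cancel_left]
    · rw [hinner₀, MemLp.inner_toLp_toLp, hone, integral_congr_ae
        (likelihoodRatio_self_ae_eq_one hpos)]
      simp
    · intro l
      rw [hinner₀, MemLp.inner_toLp_toLp, hone]
      simpa using integral_score_mul_eq_zero hpos hfin hreg hx₀ measurable_const
        (memLp_const 1) (c := 1) (fun x hx => by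
          have := isProbabilityMeasure_law hx
          simp) l
    · intro k l
      rw [hinner, MemLp.inner_toLp_toLp]
      rfl
    · intro l
      rw [hinner, MemLp.inner_toLp_toLp, meanGradient, (hmean l).lineDeriv]
      simp only [mul_comm]
  refine ⟨u₀, u, γ, fun x' => ?_, fun l x' => ?_, fun x' => ?_, hproj, ?_⟩
  · rw [hT, MemLp.inner_toLp_toLp]
    rfl
  -- The value at `x'` is `E_{x₀}{ρ(·, x') score_l}`, the derivative at `x₀` of `x ↦ E_x{ρ(·, x')}`,
  -- which equals `R(x', x)` for `x` in the parameter set.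
  · rw [hT, MemLp.inner_toLp_toLp]
    refine (hasLineDerivAt_integral_law hpos hfin hreg hx
      (measurable_likelihoodRatio hx x'.2) (hρ x') l).congr_of_eventuallyEq ?_
    filter_upwards [mem_interior_iff_mem_nhds.mp hx₀] with x hxm
    exact (integral_law_eq_mul_likelihoodRatio hpos hx hxm _).symm
  · rw [hT, MemLp.inner_toLp_toLp, mean, integral_law_eq_mul_likelihoodRatio hpos hx x'.2]
    simp only [mul_comm]
  -- With `γ(x₀)²` subtracted on both sides, it remains that the projection and `T` do not increase
  -- norms and that `‖ĝ‖² = E_{x₀}{ĝ²}`.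
  · rw [← hproj, variance_eq_sub hg]
    have h1 : ‖(spanFamily u₀ u).starProjection γ‖ ≤ ‖hg.toLp ghat‖ :=
      ((spanFamily u₀ u).norm_starProjection_apply_le γ).trans (hTle _)
    have h2 : ‖hg.toLp ghat‖ ^ 2 = ∫ y, (ghat ^ 2) y ∂(E.law x₀) := by
      rw [← real_inner_self_eq_norm_sq, MemLp.inner_toLp_toLp]
      simp only [Pi.pow_apply, sq]
    rw [← h2]
    exact sub_le_sub_right (pow_le_pow_left₀ (norm_nonneg _) h1 2) _
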